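/- Let $(X,d)$ be a compact metric space, let $\mathcal C(X)$ be the set of continuous maps $X\to X$, and let $\rho(f,g)=\sup_{x\in X}d(f(x),g(x))$. A sequence $(x_i)_{i\ge 0}$ in $X$ $\epsilon$-shadows a sequence $(y_i)_{i\ge 0}$ if $d(x_i,y_i)<\epsilon$ for all $i$; the $f$-orbit of $x$ is the sequence $(f^i(x))_{i\ge 0}$; a $\delta$-pseudo-orbit for $f$ is a sequence $(x_i)_{i\ge 0}$ with $d(f(x_i),x_{i+1})<\delta$ for all $i$; and $f$ has shadowing if for every $\epsilon>0$ there is $\delta>0$ such that every $\delta$-pseudo-orbit for $f$ is $\epsilon$-shadowed by an $f$-orbit. A c-structure on a topological space $X$ is a function $F$ assigning to each nonempty finite subset $A$ of $X$ a nonempty contractible subspace $F(A)$ of $X$ such that $A\subseteq B$ implies $F(A)\subseteq F(B)$. A nonempty set $E\subseteq X$ is an $F$-set if $F(A)\subseteq E$ for every nonempty finite $A\subseteq E$. The space $X$ with the c-structure $F$ is an m.c.-space if every point of $X$ has a neighborhood base consisting of $F$-sets. Corollary. Let $X$ be a compact metric space which either is totally disconnected or has a c-structure which makes it an m.c.-space,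 and let $f\in\mathcal C(X)$. Then $f$ has shadowing if and only if for every $\epsilon>0$ there exists $\delta>0$ such that for every $g\in\mathcal C(X)$ with $\rho(g,f)<\delta$, each $g$-orbit is $\epsilon$-shadowed by an $f$-orbit. -/

import Mathlib

open Topology

/-- `x` is a `δ`-pseudo-orbit for `f`. -/
def IsPseudoOrbit {X : Type*} [MetricSpace X] (f : X → X) (δ : ℝ) (x : ℕ → X) : Prop :=
  ∀ i, dist (f (x i)) (x (i + 1)) < δ

/-- The orbit of `x` under `f`: the sequence `x, f x, f (f x), …`. -/
def orbitSeq {X : Type*} (f : X → X) (x : X) : ℕ → X :=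
  fun i => f^[i] x

/-- The sequence `x` `ε`-shadows the sequence `y`. -/
def Shadows {X : Type*} [MetricSpace X] (ε : ℝ) (x y : ℕ → X) : Prop :=
  ∀ i, dist (x i) (y i) < ε

/-- The shadowing (pseudo-orbit tracing) property. -/
def HasShadowing {X : Type*} [MetricSpace X] (f : X → X) : Prop :=
  ∀ ε > 0, ∃ δ > 0, ∀ x : ℕ → X, IsPseudoOrbit f δ x → ∃ z : X, Shadows ε (orbitSeq f z) x

/-- A c-structure: a monotone assignment of contractible subspaces to the nonempty finite subsets
of `X`. The value at the empty finset carries no information. A `ContractibleSpace` is nonempty, so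
nonemptiness of the values needs no separate field. -/
structure CStructure (X : Type*) [TopologicalSpace X] where
  toFun : Finset X → Set X
  contractible : ∀ A : Finset X, A.Nonempty → ContractibleSpace (toFun A)
  mono : ∀ A B : Finset X, A.Nonempty → A ⊆ B → toFun A ⊆ toFun B

/-- The `F`-sets of a c-structure `F`. -/
def CStructure.IsFSet {X : Type*} [TopologicalSpace X] (F : CStructure X) (E : Set X) : Prop :=
  E.Nonempty ∧ ∀ A : Finset X, A.Nonempty → (A : Set X) ⊆ E → F.toFun A ⊆ E

/-- `X` with the c-structure `F` is an m.c.-space: every point has a neighborhood base consisting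
of (not necessarily open) `F`-sets. -/
def CStructure.IsMCSpace {X : Type*} [TopologicalSpace X] (F : CStructure X) : Prop :=
  ∀ x : X, ∀ U ∈ 𝓝 x, ∃ E ∈ 𝓝 x, F.IsFSet E ∧ E ⊆ U

/-! An orbit of a map near `f` is a pseudo-orbit of `f`, so shadowing gives one direction at once.
For the converse, a pseudo-orbit must be turned into an orbit of a continuous map near `f`.

Finitely many prescribed values near those of `f` can be interpolated by such a map
(`HasFinitePerturbations`). In a totally disconnected space this is done by redefining `f` on small
clopen sets. In an m.c.-space a partition of unity maps `X` to a simplex, and the simplex is mapped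
back skeleton by skeleton, each face into the contractible set `F` of its vertex values.

The obstacle is a pseudo-orbit that meets a point twice with different successors. Moving its points
slightly makes them distinct, except at the finite set `K` of points with finite small balls, which
are isolated. A return to a point of `K` forces that point to be periodic
(`mem_periodicPts_of_loop`), and from there the pseudo-orbit stays near the true orbit, which may
replace it. Finite stretches of the corrected sequence are then shadowed, and compactness gives a
single shadowing point. -/

/-! ### Maps of a simplex carried by contractible sets -/

/-- The face of the standard simplex spanned by the vertices in `B`. -/
def simplexFace {ι : Type*} [Fintype ι] (B : Finset ι) : Set (ι → ℝ) :=
  {x | x ∈ stdSimplex ℝ ι ∧ ∀ i, i ∉ B → x i = 0}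

theorem isClosed_simplexFace {ι : Type*} [Fintype ι] (B : Finset ι) :
    IsClosed (simplexFace B) := by
  have h : simplexFace B = stdSimplex ℝ ι ∩ ⋂ i, ⋂ (_ : i ∉ B), {x : ι → ℝ | x i = 0} := by
    ext x; simp [simplexFace]
  rw [h]
  exact (isClosed_stdSimplex ℝ ι).inter (isClosed_iInter fun i => isClosed_iInter fun _ =>
    isClosed_eq (continuous_apply i) continuous_const)

theorem sum_eq_one_of_mem_simplexFace {ι : Type*} [Fintype ι] {B : Finset ι} {x : ι → ℝ}
    (hx : x ∈ simplexFace B) : ∑ i ∈ B, x i = 1 := by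
  rw [← hx.1.2]
  exact Finset.sum_subset (Finset.subset_univ B) fun i _ hi => hx.2 i hi

/-- A contraction of a contractible subset, as a function on the ambient space. -/
theorem exists_contraction {X : Type*} [TopologicalSpace X] {Z : Set X} [ContractibleSpace Z] :
    ∃ c ∈ Z, ∃ G : ℝ × X → X, ContinuousOn G (Set.univ ×ˢ Z) ∧ (∀ t, ∀ z ∈ Z, G (t, z) ∈ Z) ∧
      (∀ z ∈ Z, G (0, z) = z) ∧ ∀ z ∈ Z, G (1, z) = c := by
  classical
  obtain ⟨c, ⟨H⟩⟩ := id_nullhomotopic Z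
  refine ⟨c, c.2, fun p => if hz : p.2 ∈ Z then
    (H (Set.projIcc 0 1 zero_le_one p.1, ⟨p.2, hz⟩) : X) else p.2, ?_, ?_, ?_, ?_⟩
  · rw [continuousOn_iff_continuous_domRestrict]
    have : Continuous fun p : (Set.univ ×ˢ Z : Set (ℝ × X)) =>
        (H (Set.projIcc 0 1 zero_le_one p.1.1, ⟨p.1.2, p.2.2⟩) : X) := by
      refine continuous_subtype_val.comp (H.continuous.comp (Continuous.prodMk ?_ ?_))
      · exact continuous_projIcc.comp (continuous_fst.comp continuous_subtype_val)
      · exact (continuous_snd.comp continuous_subtype_val).subtype_mk _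
    refine this.congr fun p => ?_
    simp [p.2.2]
  · intro t z hz
    simp [hz]
  · intro z hz
    simp [hz]
  · intro z hz
    simp [hz]

/-- A map from the boundary of a face to a contractible set extends to the face. -/
theorem exists_extension_simplexFace {ι X : Type*} [Fintype ι] [TopologicalSpace X]
    {B : Finset ι} (hB : B.Nonempty) {Z : Set X} [ContractibleSpace Z] {h : (ι → ℝ) → X}
    (hc : ContinuousOn h {x | x ∈ simplexFace B ∧ ∃ i ∈ B, x i = 0})
    (hm : ∀ x ∈ simplexFace B, (∃ i ∈ B, x i = 0) → h x ∈ Z) :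
    ∃ e : (ι → ℝ) → X, ContinuousOn e (simplexFace B) ∧ (∀ x ∈ simplexFace B, e x ∈ Z) ∧
      ∀ x ∈ simplexFace B, (∃ i ∈ B, x i = 0) → e x = h x := by
  classical
  obtain ⟨c, hcZ, G, hG, hGZ, hG0, hG1⟩ := exists_contraction (Z := Z)
  set m : (ι → ℝ) → ℝ := fun x => B.inf' hB x with hmdef
  have hmc : Continuous m := Continuous.finset_inf'_apply hB fun i _ => continuous_apply i
  have hmle : ∀ x, ∀ i ∈ B, m x ≤ x i := fun x i hi => Finset.inf'_le _ hi
  have hmatt : ∀ x, ∃ i ∈ B, m x = x i := fun x => Finset.exists_mem_eq_inf' hB x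
  have hm0 : ∀ x ∈ simplexFace B, 0 ≤ m x := fun x hx => by
    obtain ⟨i, _, hi⟩ := hmatt x
    rw [hi]; exact hx.1.1 i
  have hmz : ∀ x ∈ simplexFace B, (∃ i ∈ B, x i = 0) → m x = 0 := fun x hx ⟨i, hi, h0⟩ =>
    le_antisymm (h0 ▸ hmle x i hi) (hm0 x hx)
  -- On the face, away from the barycentre, `x` is `t x` times the barycentre plus `1 - t x` times
  -- the boundary point `r x`. The contraction is complete at `t = 1/2`, so `r` is not needed near
  -- the barycentre, where `1 - t` vanishes.
  set t : (ι → ℝ) → ℝ := fun x => B.card * m x with htdef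
  have htc : Continuous t := continuous_const.mul hmc
  set r : (ι → ℝ) → ι → ℝ := fun x i => if i ∈ B then (x i - m x) / (1 - t x) else 0 with hrdef
  have hr : ∀ x ∈ simplexFace B, t x ≤ 1 / 2 →
      r x ∈ simplexFace B ∧ ∃ i ∈ B, r x i = 0 := by
    intro x hx ht
    have hpos : 0 < 1 - t x := by linarith
    refine ⟨⟨⟨fun i => ?_, ?_⟩, fun i hi => by simp [hrdef, hi]⟩, ?_⟩
    · by_cases hi : i ∈ B
      · simpa [hrdef, hi] using div_nonneg (sub_nonneg.2 (hmle x i hi)) hpos.le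
      · simp [hrdef, hi]
    · have : ∑ i, r x i = ∑ i ∈ B, (x i - m x) / (1 - t x) := by
        simp [hrdef, Finset.sum_ite_mem]
      rw [this, ← Finset.sum_div, Finset.sum_sub_distrib, sum_eq_one_of_mem_simplexFace hx]
      simp only [Finset.sum_const, nsmul_eq_mul]
      exact div_self hpos.ne'
    · obtain ⟨i, hi, hi'⟩ := hmatt x
      exact ⟨i, hi, by simp [hrdef, hi, hi']⟩
  have hrc : ContinuousOn r {x | t x ≤ 1 / 2} := by
    refine continuousOn_pi.2 fun i => ?_
    by_cases hi : i ∈ B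
    · simp only [hrdef, hi, if_true]
      refine ((continuous_apply i).sub hmc).continuousOn.div
        (continuous_const.sub htc).continuousOn fun x hx => ?_
      have : t x ≤ 1 / 2 := hx
      linarith
    · simp only [hrdef, hi, if_false]
      exact continuousOn_const
  have hrh : ∀ x ∈ simplexFace B, t x ≤ 1 / 2 → h (r x) ∈ Z := fun x hx ht =>
    hm _ (hr x hx ht).1 (hr x hx ht).2
  refine ⟨fun x => if t x ≤ 1 / 2 then G (2 * t x, h (r x)) else c, ?_, ?_, ?_⟩
  · have hU : simplexFace B = (simplexFace B ∩ {x | t x ≤ 1 / 2}) ∪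
        (simplexFace B ∩ {x | 1 / 2 ≤ t x}) := by
      rw [← Set.inter_union_distrib_left, eq_comm, Set.inter_eq_left]
      exact fun x _ => le_total (t x) (1 / 2)
    rw [hU]
    refine ContinuousOn.union_of_isClosed ?_ ?_
      ((isClosed_simplexFace B).inter (isClosed_le htc continuous_const))
      ((isClosed_simplexFace B).inter (isClosed_le continuous_const htc))
    · have : ContinuousOn (fun x => G (2 * t x, h (r x)))
          (simplexFace B ∩ {x | t x ≤ 1 / 2}) := by
        refine hG.comp ((continuous_const.mul htc).continuousOn.prodMk
          (hc.comp (hrc.mono Set.inter_subset_right) fun x hx => hr x hx.1 hx.2)) ?_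
        exact fun x hx => ⟨trivial, hrh x hx.1 hx.2⟩
      exact this.congr fun x hx => if_pos hx.2
    · refine (continuousOn_const (c := c)).congr fun x hx => ?_
      by_cases ht : t x ≤ 1 / 2
      · have h1 : 2 * t x = 1 := by
          have : 1 / 2 ≤ t x := hx.2
          linarith
        simp only [ht, if_true, h1]
        exact hG1 _ (hrh x hx.1 ht)
      · simp only [ht, if_false]
  · intro x hx
    dsimp only
    split_ifs with ht
    · exact hGZ _ _ (hrh x hx ht)
    · exact hcZ
  · intro x hx h0
    have hm' := hmz x hx h0
    have ht : t x = 0 := by simp [htdef, hm']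
    have hrx : r x = x := by
      funext i
      by_cases hi : i ∈ B
      · simp [hrdef, hi, hm', ht]
      · simp [hrdef, hi, hx.2 i hi]
    simp only [ht, hrx, mul_zero]
    rw [if_pos (by norm_num)]
    exact hG0 _ (hm x hx h0)

/-- A monotone family of contractible sets indexed by the faces of a simplex carries a continuous
map of the simplex. -/
theorem exists_continuousOn_stdSimplex {ι X : Type*} [Fintype ι] [Nonempty X] [TopologicalSpace X]
    (Z : Finset ι → Set X) (hZ : ∀ B, B.Nonempty → ContractibleSpace (Z B))
    (hmono : ∀ A B : Finset ι, A.Nonempty → A ⊆ B → Z A ⊆ Z B) :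
    ∃ h : (ι → ℝ) → X, ContinuousOn h (stdSimplex ℝ ι) ∧
      ∀ B : Finset ι, ∀ x ∈ simplexFace B, h x ∈ Z B := by
  classical
  have hne : ∀ {B : Finset ι} {x : ι → ℝ}, x ∈ simplexFace B → B.Nonempty := by
    intro B x hx
    by_contra hB
    have := sum_eq_one_of_mem_simplexFace hx
    simp [Finset.not_nonempty_iff_eq_empty.1 hB] at this
  have key : ∀ k : ℕ, ∃ h : (ι → ℝ) → X, ∀ B : Finset ι, B.card ≤ k →
      ContinuousOn h (simplexFace B) ∧ ∀ x ∈ simplexFace B, h x ∈ Z B := by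
    intro k
    induction k with
    | zero =>
      refine ⟨fun _ => Classical.arbitrary X, fun B hB => ⟨continuousOn_const, fun x hx => ?_⟩⟩
      have := (hne hx).card_pos
      omega
    | succ k ih =>
      obtain ⟨h, hh⟩ := ih
      have hext : ∀ B : Finset ι, ∃ e : (ι → ℝ) → X, B.card = k + 1 →
          ContinuousOn e (simplexFace B) ∧ (∀ x ∈ simplexFace B, e x ∈ Z B) ∧
          ∀ x ∈ simplexFace B, (∃ i ∈ B, x i = 0) → e x = h x := by
        intro B
        by_cases hB : B.card = k + 1
        · have hBne : B.Nonempty := Finset.card_pos.1 (by omega)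
          have := hZ B hBne
          have hface : ∀ x ∈ simplexFace B, ∀ i, x i = 0 → x ∈ simplexFace (B.erase i) := by
            refine fun x hx i hi => ⟨hx.1, fun j hj => ?_⟩
            by_cases hji : j = i
            · rw [hji, hi]
            · exact hx.2 j fun hjB => hj (Finset.mem_erase.2 ⟨hji, hjB⟩)
          have hcard : ∀ i ∈ B, (B.erase i).card ≤ k := fun i hi => by
            rw [Finset.card_erase_of_mem hi]; omega
          obtain ⟨e, he⟩ := exists_extension_simplexFace hBne (Z := Z B) (h := h)
            ((LocallyFinite.continuousOn_iUnion (f := fun i : B => simplexFace (B.erase i.1))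
              (locallyFinite_of_finite _) (fun i => isClosed_simplexFace _)
              (fun i => (hh _ (hcard i.1 i.2)).1)).mono
              fun x ⟨hx, i, hi, h0⟩ => Set.mem_iUnion.2 ⟨⟨i, hi⟩, hface x hx i h0⟩)
            (fun x hx ⟨i, hi, h0⟩ => by
              have hx' := hface x hx i h0
              exact hmono _ _ (hne hx') (Finset.erase_subset i B) ((hh _ (hcard i hi)).2 x hx'))
          exact ⟨e, fun _ => he⟩
        · exact ⟨h, fun h' => absurd h' hB⟩
      choose e he using hext
      -- The support spans the smallest face containing `x`, so the pieces `e B` are selected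
      -- consistently and differ from `h` only in the interiors of the new faces.
      let supp : (ι → ℝ) → Finset ι := fun x => Finset.univ.filter fun i => x i ≠ 0
      have hsupp : ∀ {B : Finset ι} {x : ι → ℝ}, x ∈ simplexFace B → supp x ⊆ B := by
        intro B x hx i hi
        by_contra hiB
        exact (Finset.mem_filter.1 hi).2 (hx.2 i hiB)
      refine ⟨fun x => if (supp x).card ≤ k then h x else e (supp x) x, fun B hB => ?_⟩
      rcases Nat.lt_or_ge k B.card with hlt | hle
      · have hBk : B.card = k + 1 := by omega
        have heq : ∀ x ∈ simplexFace B,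
            (if (supp x).card ≤ k then h x else e (supp x) x) = e B x := by
          intro x hx
          split_ifs with hs
          · obtain ⟨i, hi, hi'⟩ := Finset.exists_mem_notMem_of_card_lt_card
              (show (supp x).card < B.card by omega)
            refine ((he B hBk).2.2 x hx ⟨i, hi, ?_⟩).symm
            by_contra h0
            exact hi' (Finset.mem_filter.2 ⟨Finset.mem_univ i, h0⟩)
          · rw [Finset.eq_of_subset_of_card_le (hsupp hx) (by omega)]
        exact ⟨(he B hBk).1.congr heq, fun x hx => by
          simpa only [heq x hx] using (he B hBk).2.1 x hx⟩
      · have heq : ∀ x ∈ simplexFace B,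
            (if (supp x).card ≤ k then h x else e (supp x) x) = h x := fun x hx =>
          if_pos ((Finset.card_le_card (hsupp hx)).trans hle)
        exact ⟨(hh B hle).1.congr heq, fun x hx => by
          simpa only [heq x hx] using (hh B hle).2 x hx⟩
  obtain ⟨h, hh⟩ := key (Fintype.card ι)
  refine ⟨h, (hh Finset.univ le_rfl).1.mono fun x hx => ⟨hx, fun i hi => ?_⟩,
    fun B => (hh B (Finset.card_le_univ B)).2⟩
  exact absurd (Finset.mem_univ i) hi

/-! ### Interpolation of finitely many values near `f` -/

/-- `F {a}` lies in arbitrarily small neighborhoods of `a`. This makes the interpolating map exact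
at the prescribed points. -/
theorem CStructure.IsMCSpace.toFun_singleton {X : Type*} [TopologicalSpace X] [T1Space X]
    {F : CStructure X} (hF : F.IsMCSpace) {a x : X} (hx : x ∈ F.toFun {a}) : x = a := by
  by_contra hne
  obtain ⟨E, hE, hFE, hEU⟩ := hF a {x}ᶜ (isOpen_compl_singleton.mem_nhds fun h => hne h.symm)
  exact hEU (hFE.2 {a} (Finset.singleton_nonempty a)
    (by simpa using mem_of_mem_nhds hE) hx) rfl

/-- Every finite set of values close to those of `f` is attained by a continuous map
close to `f`. -/
def HasFinitePerturbations {X : Type*} [MetricSpace X] [CompactSpace X] (f : C(X, X)) : Prop :=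
  ∀ ε > 0, ∃ δ > 0, ∀ (P : Finset X) (q : X → X), (∀ p ∈ P, dist (q p) (f p) < δ) →
    ∃ g : C(X, X), dist g f < ε ∧ ∀ p ∈ P, g p = q p

theorem hasFinitePerturbations_of_totallyDisconnected {X : Type*} [MetricSpace X] [CompactSpace X]
    [TotallyDisconnectedSpace X] (f : C(X, X)) : HasFinitePerturbations f := by
  classical
  intro ε hε
  refine ⟨ε / 2, half_pos hε, fun P q => ?_⟩
  induction P using Finset.induction_on with
  | empty => exact fun _ => ⟨f, by simpa using hε, by simp⟩
  | insert p P hp ih =>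
    intro hq
    obtain ⟨g, hg, hgP⟩ := ih fun x hx => hq x (Finset.mem_insert_of_mem hx)
    -- `W` avoids the points already treated, so making the map constant on it keeps their values.
    obtain ⟨W, hW, hpW, hWU⟩ := compact_exists_isClopen_in_isOpen
      (U := f ⁻¹' Metric.ball (f p) (ε / 2) ∩ (P : Set X)ᶜ)
      ((Metric.isOpen_ball.preimage f.continuous).inter P.finite_toSet.isClosed.isOpen_compl)
      (x := p) ⟨Metric.mem_ball_self (half_pos hε), by simpa using hp⟩
    have hcont : Continuous (W.piecewise (fun _ => q p) g) :=
      continuous_const.piecewise (by simp [hW.frontier_eq]) g.continuous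
    refine ⟨⟨_, hcont⟩, (ContinuousMap.dist_lt_iff hε).2 fun x => ?_, fun x hx => ?_⟩
    · by_cases hx : x ∈ W
      · have h1 : dist (f x) (f p) < ε / 2 := (hWU hx).1
        have h2 := hq p (Finset.mem_insert_self p P)
        rw [dist_comm] at h1
        simpa [hx] using (dist_triangle (q p) (f p) (f x)).trans_lt (by linarith)
      · simpa [hx] using (ContinuousMap.dist_lt_iff hε).1 hg x
    · rcases Finset.mem_insert.1 hx with rfl | hxP
      · simp [hpW]
      · have : x ∉ W := fun h => (hWU h).2 hxP
        simpa [this] using hgP x hxP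

theorem CStructure.IsMCSpace.hasFinitePerturbations {X : Type*} [MetricSpace X] [CompactSpace X]
    {F : CStructure X} (hF : F.IsMCSpace) (f : C(X, X)) : HasFinitePerturbations f := by
  classical
  intro ε hε
  choose E hE hFE hEU using fun x : X => hF x _ (Metric.ball_mem_nhds x (half_pos hε))
  -- With a Lebesgue number `δ`, the vertex values used at `x`, all within `δ` of `f x`, lie in one
  -- `F`-set `E y`, which then also contains the value of the new map.
  obtain ⟨δ, hδ, hδE⟩ := lebesgue_number_lemma_of_metric (isCompact_univ (X := X))
    (c := fun x => interior (E x)) (fun _ => isOpen_interior)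
    fun x _ => Set.mem_iUnion.2 ⟨x, mem_interior_iff_mem_nhds.2 (hE x)⟩
  obtain ⟨η, hη, hfη⟩ := Metric.uniformContinuous_iff.1
    (CompactSpace.uniformContinuous_of_continuous f.continuous) (δ / 2) (half_pos hδ)
  refine ⟨δ / 2, half_pos hδ, fun P q hq => ?_⟩
  obtain hemp | hnonempty := isEmpty_or_nonempty X
  · exact ⟨f, by simpa using hε, fun p => isEmptyElim p⟩
  obtain ⟨C, -, hCfin, hC⟩ := finite_cover_balls_of_compact (isCompact_univ (X := X)) hη
  let T : Finset X := hCfin.toFinset ∪ P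
  let v : T → X := fun t => if t.1 ∈ P then q t else f t
  have hv : ∀ t, dist (v t) (f t) < δ / 2 := fun t => by
    by_cases ht : t.1 ∈ P
    · simpa [v, ht] using hq t ht
    · simpa [v, ht] using half_pos hδ
  -- Deleting the other points of `P` leaves only the index `p` active at each `p ∈ P`.
  let U : T → Set X := fun t => Metric.ball t.1 η \ ((P.erase t.1 : Finset X) : Set X)
  obtain ⟨φ, hφ⟩ := PartitionOfUnity.exists_isSubordinate (isClosed_univ (X := X)) U
    (fun t => Metric.isOpen_ball.sdiff (Finset.finite_toSet _).isClosed) (by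
      intro x _
      by_cases hx : x ∈ P
      · exact Set.mem_iUnion.2 ⟨⟨x, Finset.mem_union_right _ hx⟩, Metric.mem_ball_self hη,
          by simp⟩
      · obtain ⟨c, hc, hxc⟩ := Set.mem_iUnion₂.1 (hC (Set.mem_univ x))
        exact Set.mem_iUnion.2 ⟨⟨c, Finset.mem_union_left _ (hCfin.mem_toFinset.2 hc)⟩, hxc,
          by simp [hx]⟩)
  have hφU : ∀ x t, φ t x ≠ 0 → x ∈ U t := fun x t h => hφ t (subset_tsupport _ h)
  obtain ⟨h, hc, hh⟩ := exists_continuousOn_stdSimplex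
    (fun B : Finset T => F.toFun (B.image v)) (fun B hB => F.contractible _ (hB.image v))
    (fun A B hA hAB => F.mono _ _ (hA.image v) (Finset.image_subset_image hAB))
  have hmem : ∀ x, (fun t => φ t x) ∈ stdSimplex ℝ T := fun x =>
    ⟨fun t => φ.nonneg t x, by
      rw [← finsum_eq_sum_of_fintype]; exact φ.sum_eq_one (Set.mem_univ x)⟩
  have hcont : Continuous fun x => h fun t => φ t x :=
    hc.comp_continuous (continuous_pi fun t => (φ t).continuous) hmem
  have hloc : ∀ x, ∀ B : Finset T, (∀ t, φ t x ≠ 0 → t ∈ B) →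
      (h fun t => φ t x) ∈ F.toFun (B.image v) := fun x B hB =>
    hh B _ ⟨hmem x, fun t ht => by_contra fun h0 => ht (hB t h0)⟩
  refine ⟨⟨_, hcont⟩, (ContinuousMap.dist_lt_iff hε).2 fun x => ?_, fun p hp => ?_⟩
  · obtain ⟨y, hy⟩ := hδE (f x) (Set.mem_univ _)
    let B : Finset T := Finset.univ.filter fun t => φ t x ≠ 0
    have hBne : B.Nonempty := by
      by_contra hB
      have h0 : ∀ t, φ t x = 0 := fun t => by_contra fun h0 =>
        hB ⟨t, Finset.mem_filter.2 ⟨Finset.mem_univ t, h0⟩⟩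
      simpa [h0] using (hmem x).2
    have h1 : (h fun t => φ t x) ∈ E y := by
      refine (hFE y).2 (B.image v) (hBne.image v) ?_ (hloc x B fun t ht =>
        Finset.mem_filter.2 ⟨Finset.mem_univ t, ht⟩)
      intro z hz
      obtain ⟨t, ht, rfl⟩ := Finset.mem_image.1 hz
      have hxt : dist x t < η := (hφU x t (Finset.mem_filter.1 ht).2).1
      have h2 := hfη hxt
      rw [dist_comm] at h2
      refine interior_subset (hy ?_)
      exact (dist_triangle _ (f t) _).trans_lt (by linarith [hv t])
    have h2 : dist (h fun t => φ t x) y < ε / 2 := hEU y h1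
    have h3 : dist (f x) y < ε / 2 := hEU y (interior_subset (hy (Metric.mem_ball_self hδ)))
    exact (dist_triangle_right (h fun t => φ t x) (f x) y).trans_lt (by linarith)
  · have hpT : p ∈ T := Finset.mem_union_right _ hp
    have h1 := hloc p {⟨p, hpT⟩} fun t ht => by
      have h2 := (hφU p t ht).2
      by_contra hne
      refine h2 (Finset.mem_coe.2 (Finset.mem_erase.2 ⟨fun h => hne ?_, hp⟩))
      exact Finset.mem_singleton.2 (Subtype.ext h.symm)
    rw [Finset.image_singleton] at h1
    have h2 := hF.toFun_singleton h1
    simpa [v, hp] using h2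

/-! ### Finite chains as orbits of perturbed maps -/

/-- Shadowing of finite chains that are traced by a partial function. -/
theorem HasFinitePerturbations.exists_shadowing_chain {X : Type*} [MetricSpace X] [CompactSpace X]
    {f : C(X, X)} (hf : HasFinitePerturbations f)
    (h : ∀ ε > 0, ∃ δ > 0, ∀ g : C(X, X), dist g f < δ →
      ∀ x : X, ∃ z : X, Shadows ε (orbitSeq f z) (orbitSeq g x)) {ε : ℝ} (hε : 0 < ε) :
    ∃ δ > 0, ∀ (y : ℕ → X) (N : ℕ), (∀ i < N, ∀ j < N, y i = y j → y (i + 1) = y (j + 1)) →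
      (∀ i < N, dist (f (y i)) (y (i + 1)) < δ) → ∃ z, ∀ i ≤ N, dist (f^[i] z) (y i) < ε := by
  classical
  obtain ⟨δ₁, hδ₁, h⟩ := h ε hε
  obtain ⟨δ, hδ, hf⟩ := hf δ₁ hδ₁
  refine ⟨δ, hδ, fun y N hy hd => ?_⟩
  -- Any index `j` will do, since equal points of the chain have equal successors.
  let q : X → X := fun p => if hp : ∃ j < N, y j = p then y (hp.choose + 1) else p
  have hq : ∀ i < N, q (y i) = y (i + 1) := fun i hi => by
    have hp : ∃ j < N, y j = y i := ⟨i, hi, rfl⟩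
    simp only [q, dif_pos hp]
    exact hy _ hp.choose_spec.1 _ hi hp.choose_spec.2
  obtain ⟨g, hgf, hg⟩ := hf ((Finset.range N).image y) q (fun p hp => by
    obtain ⟨i, hi, rfl⟩ := Finset.mem_image.1 hp
    rw [hq i (Finset.mem_range.1 hi), dist_comm]
    exact hd i (Finset.mem_range.1 hi))
  have horb : ∀ i ≤ N, g^[i] (y 0) = y i := by
    intro i
    induction i with
    | zero => simp
    | succ i ih =>
      intro hi
      rw [Function.iterate_succ_apply', ih (by omega),
        hg _ (Finset.mem_image_of_mem y (Finset.mem_range.2 hi)), hq i hi]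
  obtain ⟨z, hz⟩ := h g hgf (y 0)
  exact ⟨z, fun i hi => horb i hi ▸ hz i⟩

/-! ### Pseudo-orbits at isolated points -/

theorem exists_dist_iterate_lt {X : Type*} [MetricSpace X] {f : X → X} (hf : UniformContinuous f)
    (n : ℕ) {ε : ℝ} (hε : 0 < ε) :
    ∃ δ > 0, ∀ x, IsPseudoOrbit f δ x → ∀ i ≤ n, dist (f^[i] (x 0)) (x i) < ε := by
  induction n generalizing ε with
  | zero =>
    refine ⟨1, one_pos, fun x _ i hi => ?_⟩
    simpa [Nat.le_zero.1 hi] using hε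
  | succ n ih =>
    obtain ⟨η, hη, hfη⟩ := Metric.uniformContinuous_iff.1 hf (ε / 2) (half_pos hε)
    obtain ⟨δ, hδ, h⟩ := ih (lt_min hη hε)
    refine ⟨min δ (ε / 2), lt_min hδ (half_pos hε), fun x hx i hi => ?_⟩
    have hx' : IsPseudoOrbit f δ x := fun i => (hx i).trans_le (min_le_left _ _)
    rcases Nat.of_le_succ hi with hi | rfl
    · exact (h x hx' i hi).trans_le (min_le_right _ _)
    · rw [Function.iterate_succ_apply']
      have h1 := hfη ((h x hx' n le_rfl).trans_le (min_le_left _ _))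
      have h2 := (hx n).trans_le (min_le_right _ _)
      exact (dist_triangle _ _ _).trans_lt (by linarith)

/-- Pseudo-orbits starting at an isolated periodic point follow its orbit. -/
theorem exists_shadows_orbitSeq_of_periodic {X : Type*} [MetricSpace X] {f : X → X}
    (hf : UniformContinuous f) {k : X} (hk : k ∈ Function.periodicPts f) {r : ℝ} (hr : 0 < r)
    (hkr : ∀ a, dist k a < r → a = k) {ε : ℝ} (hε : 0 < ε) :
    ∃ δ > 0, ∀ x, IsPseudoOrbit f δ x → x 0 = k → Shadows ε (orbitSeq f k) x := by
  obtain ⟨n, hn, hper⟩ := hk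
  -- Precision `r` forces an exact return to `k` after each period, so errors never accumulate.
  obtain ⟨δ, hδ, h⟩ := exists_dist_iterate_lt hf n (lt_min hε hr)
  refine ⟨δ, hδ, fun x hx hx0 => ?_⟩
  have hshift : ∀ a, x a = k → ∀ i ≤ n, dist (f^[i] k) (x (a + i)) < min ε r := by
    intro a ha i hi
    have := h (fun i => x (a + i)) (fun i => hx (a + i)) i hi
    simpa [ha] using this
  have hret : ∀ j, x (n * j) = k := by
    intro j
    induction j with
    | zero => simpa using hx0
    | succ j ih =>
      have := hshift _ ih n le_rfl
      rw [hper.eq] at this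
      exact hkr _ (this.trans_le (min_le_right _ _))
  intro i
  have := hshift _ (hret (i / n)) (i % n) (Nat.mod_lt i hn).le
  rw [hper.iterate_mod_apply, Nat.div_add_mod] at this
  exact this.trans_le (min_le_left _ _)

/-- If injective pseudo-loops at an isolated point are shadowed, then every pseudo-loop there
forces periodicity. -/
theorem mem_periodicPts_of_loop {X : Type*} [MetricSpace X] {f : X → X} {k : X} {r δ : ℝ}
    (hkr : ∀ a, dist a k < r → a = k)
    (h : ∀ (y : ℕ → X) (N : ℕ), (∀ i < N, ∀ j < N, y i = y j → y (i + 1) = y (j + 1)) →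
      (∀ i < N, dist (f (y i)) (y (i + 1)) < δ) → ∃ z, ∀ i ≤ N, dist (f^[i] z) (y i) < r)
    (n : ℕ) (hn : 0 < n) (w : ℕ → X) (hw0 : w 0 = k) (hwn : w n = k)
    (hw : ∀ i < n, dist (f (w i)) (w (i + 1)) < δ) : k ∈ Function.periodicPts f := by
  induction n using Nat.strong_induction_on generalizing w with
  | _ n ih =>
    by_cases hinj : ∀ a b, a < b → b < n → w a ≠ w b
    · obtain ⟨z, hz⟩ := h w n (fun i hi j hj hij => by
        rcases lt_trichotomy i j with hlt | rfl | hlt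
        · exact absurd hij (hinj i j hlt hj)
        · rfl
        · exact absurd hij.symm (hinj j i hlt hi)) hw
      have hzk : z = k := hkr z (by simpa [hw0] using hz 0 n.zero_le)
      exact ⟨n, hn, hkr _ (by simpa [hzk, hwn] using hz n le_rfl)⟩
    · push Not at hinj
      obtain ⟨a, b, hab, hbn, hwab⟩ := hinj
      -- Cut out the stretch between the two visits `a < b` to one point; since `b < n`, a loop of
      -- positive length remains.
      refine ih (n - (b - a)) (by omega) (by omega)
        (fun i => if i ≤ a then w i else w (i + (b - a))) (by simpa using hw0) ?_ ?_
      · simp only [show ¬ n - (b - a) ≤ a by omega, if_false]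
        rwa [show n - (b - a) + (b - a) = n by omega]
      · intro i hi
        rcases lt_trichotomy i a with hia | rfl | hia
        · simpa [hia.le, Nat.succ_le_of_lt hia] using hw i (by omega)
        · have := hw b hbn
          rw [← hwab] at this
          simpa [show i + 1 + (b - i) = b + 1 by omega] using this
        · have := hw (i + (b - a)) (by omega)
          simpa [show ¬ i ≤ a by omega, show ¬ i + 1 ≤ a by omega,
            show i + 1 + (b - a) = i + (b - a) + 1 by omega] using this

/-! ### Injective perturbation of sequences -/

open Classical in
/-- The sequence that takes a new element of `A n` at each step, as long as there is one. -/
noncomputable def greedyChoice {X : Type*} (A : ℕ → Set X) (x : ℕ → X) : ℕ → X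
  | n => if h : (A n \ Set.range fun i : Fin n => greedyChoice A x i.1).Nonempty
      then h.choose else x n
  decreasing_by exact i.2

theorem greedyChoice_mem {X : Type*} {A : ℕ → Set X} {x : ℕ → X} {n : ℕ} (h : (A n).Infinite) :
    greedyChoice A x n ∈ A n \ Set.range fun i : Fin n => greedyChoice A x i.1 := by
  have hne := (h.sdiff (Set.finite_range fun i : Fin n => greedyChoice A x i.1)).nonempty
  rw [greedyChoice, dif_pos hne]
  exact hne.choose_spec

theorem greedyChoice_injOn {X : Type*} {A : ℕ → Set X} {x : ℕ → X} :
    Set.InjOn (greedyChoice A x) {n | (A n).Infinite} := by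
  intro i hi j hj hij
  rcases lt_trichotomy i j with h | h | h
  · exact absurd ⟨⟨i, h⟩, hij⟩ (greedyChoice_mem (x := x) hj).2
  · exact h
  · exact absurd ⟨⟨j, h⟩, hij.symm⟩ (greedyChoice_mem (x := x) hi).2

/-- A sequence can be made injective, away from a finite set `K`, by a small perturbation. -/
theorem exists_perturbation_injective {X : Type*} [MetricSpace X] {K O : Set X} {η : ℝ}
    (hη : 0 < η) (hK : K.Finite) (hO : O.Finite) (hinf : ∀ a ∉ K, (Metric.ball a η).Infinite)
    (x : ℕ → X) :
    ∃ y : ℕ → X, (∀ i, dist (y i) (x i) < η) ∧ (∀ i, x i ∈ K → y i = x i) ∧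
      (∀ i, x i ∉ K → y i ∉ K ∧ y i ∉ O) ∧ ∀ i j, x i ∉ K → x j ∉ K → y i = y j → i = j := by
  classical
  let A : ℕ → Set X := fun i => Metric.ball (x i) η \ (K ∪ O)
  have hA : ∀ i, x i ∉ K → (A i).Infinite := fun i hi => (hinf _ hi).sdiff (hK.union hO)
  have hmem : ∀ i, x i ∉ K → greedyChoice A x i ∈ A i := fun i hi =>
    (greedyChoice_mem (hA i hi)).1
  refine ⟨fun i => if x i ∈ K then x i else greedyChoice A x i, fun i => ?_, fun i hi => ?_,
    fun i hi => ?_, fun i j hi hj hij => ?_⟩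
  · by_cases hi : x i ∈ K
    · simpa [hi] using hη
    · simpa [hi] using (hmem i hi).1
  · simp [hi]
  · simpa [hi] using (hmem i hi).2
  · simp only [hi, hj, if_false] at hij
    exact greedyChoice_injOn (hA i hi) (hA j hj) hij

/-! ### Compactness: finite balls and limits of shadowing points -/

/-- Each ball of radius `η / 2` in a finite cover lies in the `η`-ball of any of its points, so it
is finite as soon as it contains one such point. -/
theorem finite_setOf_finite_ball {X : Type*} [MetricSpace X] [CompactSpace X] {η : ℝ}
    (hη : 0 < η) : {a : X | (Metric.ball a η).Finite}.Finite := by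
  classical
  obtain ⟨C, -, hCfin, hC⟩ := finite_cover_balls_of_compact (isCompact_univ (X := X))
    (half_pos hη)
  refine (hCfin.biUnion (t := fun c => {a | a ∈ Metric.ball c (η / 2) ∧
    (Metric.ball a η).Finite}) fun c _ => ?_).subset fun a ha => ?_
  · by_cases hne : ∃ a ∈ Metric.ball c (η / 2), (Metric.ball a η).Finite
    · obtain ⟨a, hac, ha⟩ := hne
      refine ha.subset fun b hb => ?_
      have h1 : dist a c < η / 2 := hac
      have h2 : dist b c < η / 2 := hb.1
      exact (dist_triangle_right b a c).trans_lt (by linarith)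
    · convert Set.finite_empty (α := X)
      ext a
      simpa using fun h1 h2 => hne ⟨a, h1, h2⟩
  · obtain ⟨c, hc, hac⟩ := Set.mem_iUnion₂.1 (hC (Set.mem_univ a))
    exact Set.mem_iUnion₂.2 ⟨c, hc, hac, ha⟩

/-- A finite set of points with a finite ball is uniformly isolated. -/
theorem exists_isolation_radius {X : Type*} [MetricSpace X] {K : Set X} (hK : K.Finite) {η : ℝ}
    (hη : 0 < η) (hfin : ∀ k ∈ K, (Metric.ball k η).Finite) :
    ∃ r > 0, ∀ k ∈ K, ∀ a, dist a k < r → a = k := by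
  have h : ∀ᶠ r in 𝓝[>] (0 : ℝ), ∀ k ∈ K, ∀ a, dist a k < r → a = k := by
    refine (Filter.eventually_all_finite hK).2 fun k hk => ?_
    have hopen : Metric.ball k η \ (Metric.ball k η \ {k}) ∈ 𝓝 k :=
      (Metric.isOpen_ball.sdiff ((hfin k hk).subset Set.sdiff_subset).isClosed).mem_nhds
        ⟨Metric.mem_ball_self hη, by simp⟩
    obtain ⟨r, hr, hball⟩ := Metric.mem_nhds_iff.1 hopen
    filter_upwards [Ioo_mem_nhdsGT hr] with s hs a ha
    have := hball (Metric.mem_ball.2 (ha.trans hs.2))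
    by_contra hne
    exact this.2 ⟨this.1, hne⟩
  obtain ⟨r, hr, hpos⟩ := (h.and self_mem_nhdsWithin).exists
  exact ⟨r, hpos, hr⟩

theorem exists_shadow_of_finite_shadows {X : Type*} [MetricSpace X] [CompactSpace X]
    {f : X → X} (hf : Continuous f) {ε : ℝ} {x : ℕ → X}
    (h : ∀ N : ℕ, ∃ z, ∀ i ≤ N, dist (f^[i] z) (x i) ≤ ε) :
    ∃ z, ∀ i, dist (f^[i] z) (x i) ≤ ε := by
  choose z hz using h
  obtain ⟨a, φ, hφ, ha⟩ := CompactSpace.tendsto_subseq z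
  refine ⟨a, fun i => le_of_tendsto
    ((((hf.iterate i).tendsto a).comp ha).dist tendsto_const_nhds) ?_⟩
  filter_upwards [Filter.eventually_ge_atTop i] with n hn
  exact hz (φ n) i (hn.trans (hφ.id_le n))

/-! ### The two implications -/

theorem HasShadowing.exists_shadows_orbitSeq {X : Type*} [MetricSpace X] [CompactSpace X]
    {f : C(X, X)} (hf : HasShadowing f) :
    ∀ ε > 0, ∃ δ > 0, ∀ g : C(X, X), dist g f < δ →
      ∀ x : X, ∃ z : X, Shadows ε (orbitSeq f z) (orbitSeq g x) := by
  intro ε hε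
  obtain ⟨δ, hδ, h⟩ := hf ε hε
  refine ⟨δ, hδ, fun g hg x => h _ fun i => ?_⟩
  rw [orbitSeq, orbitSeq, Function.iterate_succ_apply', dist_comm]
  exact (ContinuousMap.dist_lt_iff hδ).1 hg _

theorem HasFinitePerturbations.hasShadowing {X : Type*} [MetricSpace X] [CompactSpace X]
    {f : C(X, X)} (hf : HasFinitePerturbations f)
    (h : ∀ ε > 0, ∃ δ > 0, ∀ g : C(X, X), dist g f < δ →
      ∀ x : X, ∃ z : X, Shadows ε (orbitSeq f z) (orbitSeq g x)) : HasShadowing f := by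
  classical
  intro ε hε
  have hε3 : 0 < ε / 3 := by positivity
  have huc : UniformContinuous f := CompactSpace.uniformContinuous_of_continuous f.continuous
  -- The thirds of `δ₁` pay for the move of `y i` under `f`, the jump of `x` and the move of `y (i +
  -- 1)`.
  obtain ⟨δ₁, hδ₁, hchain⟩ := hf.exists_shadowing_chain h hε3
  have hδ₁3 : 0 < δ₁ / 3 := by positivity
  obtain ⟨η₀, hη₀, hfη₀⟩ := Metric.uniformContinuous_iff.1 huc (δ₁ / 3) hδ₁3
  obtain ⟨η, hη, hη₀', hηδ, hηε⟩ : ∃ η > 0, η ≤ η₀ ∧ η ≤ δ₁ / 3 ∧ η ≤ ε / 3 :=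
    ⟨min η₀ (min (δ₁ / 3) (ε / 3)), lt_min hη₀ (lt_min hδ₁3 hε3), min_le_left _ _,
      (min_le_right _ _).trans (min_le_left _ _), (min_le_right _ _).trans (min_le_right _ _)⟩
  let K : Set X := {a : X | (Metric.ball a η).Finite}
  have hK : K.Finite := finite_setOf_finite_ball hη
  obtain ⟨r, hr, hrK⟩ := exists_isolation_radius hK hη fun k hk => hk
  -- At precision `r` a shadowing point near `k ∈ K` is `k` itself, so loops there yield
  -- periodicity.
  obtain ⟨δ₂, hδ₂, hloop⟩ := hf.exists_shadowing_chain h hr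
  obtain ⟨δ₃, htrack, hδ₃⟩ : ∃ δ, (∀ k ∈ K, k ∈ Function.periodicPts f → ∀ x,
      IsPseudoOrbit f δ x → x 0 = k → Shadows (ε / 3) (orbitSeq f k) x) ∧ 0 < δ := by
    have : ∀ᶠ δ in 𝓝[>] (0 : ℝ), ∀ k ∈ K, k ∈ Function.periodicPts f → ∀ x,
        IsPseudoOrbit f δ x → x 0 = k → Shadows (ε / 3) (orbitSeq f k) x := by
      refine (Filter.eventually_all_finite hK).2 fun k hk => ?_
      by_cases hper : k ∈ Function.periodicPts f
      · obtain ⟨δ, hδ, hx⟩ := exists_shadows_orbitSeq_of_periodic huc hper hr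
          (fun a ha => hrK k hk a (by rwa [dist_comm])) hε3
        filter_upwards [Ioo_mem_nhdsGT hδ] with s hs _ x hs'
        exact hx x fun i => (hs' i).trans hs.2
      · exact Filter.Eventually.of_forall fun _ h => absurd h hper
    exact (this.and self_mem_nhdsWithin).exists
  refine ⟨min (δ₁ / 3) (min δ₂ δ₃), lt_min hδ₁3 (lt_min hδ₂ hδ₃), fun x hx => ?_⟩
  have hx₁ : ∀ i, dist (f (x i)) (x (i + 1)) < δ₁ / 3 := fun i => (hx i).trans_le (min_le_left _ _)
  have hx₂ : ∀ i, dist (f (x i)) (x (i + 1)) < δ₂ := fun i =>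
    (hx i).trans_le ((min_le_right _ _).trans (min_le_left _ _))
  have hx₃ : ∀ i, dist (f (x i)) (x (i + 1)) < δ₃ := fun i =>
    (hx i).trans_le ((min_le_right _ _).trans (min_le_right _ _))
  have hrep : ∀ i j, i < j → x i ∈ K → x i = x j → x i ∈ Function.periodicPts f := by
    intro i j hij hi hxij
    refine mem_periodicPts_of_loop (hrK _ hi) hloop (j - i) (by omega) (fun n => x (i + n)) rfl ?_
      fun n _ => hx₂ (i + n)
    simp only [show i + (j - i) = j by omega, hxij]
  have hinj : ∀ y : ℕ → X, (∀ i, x i ∈ K → y i = x i) → (∀ i, x i ∉ K → y i ∉ K) →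
      (∀ i j, x i ∉ K → x j ∉ K → y i = y j → i = j) → ∀ i j,
      (x i ∈ K → x i ∉ Function.periodicPts f) → (x j ∈ K → x j ∉ Function.periodicPts f) →
      y i = y j → i = j := by
    intro y hyK hyK' hyinj i j hi hj hij
    by_cases hiK : x i ∈ K <;> by_cases hjK : x j ∈ K
    · have hxij : x i = x j := by rw [← hyK i hiK, ← hyK j hjK, hij]
      rcases lt_trichotomy i j with hlt | heq | hlt
      · exact absurd (hrep i j hlt hiK hxij) (hi hiK)
      · exact heq
      · exact absurd (hrep j i hlt hjK hxij.symm) (hj hjK)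
    · exact absurd (hij ▸ (hyK i hiK).symm ▸ hiK) (hyK' j hjK)
    · exact absurd (hij.symm ▸ (hyK j hjK).symm ▸ hjK) (hyK' i hiK)
    · exact hyinj i j hiK hjK hij
  have hstep : ∀ a a' b b', dist a' a < η → dist b' b < η → dist (f a) b < δ₁ / 3 →
      dist (f a') b' < δ₁ := by
    intro a a' b b' ha hb hab
    have h1 := hfη₀ (ha.trans_le hη₀')
    rw [dist_comm] at hb
    exact (dist_triangle4 _ (f a) b _).trans_lt (by linarith)
  suffices hy : ∃ y : ℕ → X, (∀ i j, y i = y j → y (i + 1) = y (j + 1)) ∧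
      (∀ i, dist (f (y i)) (y (i + 1)) < δ₁) ∧ ∀ i, dist (y i) (x i) < ε / 3 by
    obtain ⟨y, hyfun, hyd, hyx⟩ := hy
    obtain ⟨z, hz⟩ := exists_shadow_of_finite_shadows f.continuous (ε := ε / 3) (x := y) fun N => by
      obtain ⟨z, hz⟩ := hchain y N (fun i _ j _ => hyfun i j) fun i _ => hyd i
      exact ⟨z, fun i hi => (hz i hi).le⟩
    exact ⟨z, fun i => (dist_triangle (f^[i] z) (y i) _).trans_lt (by linarith [hz i, hyx i])⟩
  by_cases hvisit : ∃ m, x m ∈ K ∧ x m ∈ Function.periodicPts f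
  -- At the first visit `m` to a periodic point of `K`, the sequence switches to its true orbit.
  -- Earlier terms are distinct and avoid that finite orbit, so successors stay well defined.
  · obtain ⟨hmK, hmper⟩ := Nat.find_spec hvisit
    have hmin : ∀ i < Nat.find hvisit, x i ∈ K → x i ∉ Function.periodicPts f :=
      fun i hi hiK hiper => Nat.find_min hvisit hi ⟨hiK, hiper⟩
    generalize Nat.find hvisit = m at hmK hmper hmin
    have hO : (Set.range fun j => f^[j] (x m)).Finite := by
      obtain ⟨n, hn, hper⟩ := hmper
      refine ((Set.finite_Iio n).image fun j => f^[j] (x m)).subset ?_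
      rintro _ ⟨j, rfl⟩
      exact ⟨j % n, Nat.mod_lt j hn, hper.iterate_mod_apply j⟩
    obtain ⟨y, hyx, hyK, hyK', hyinj⟩ := exists_perturbation_injective hη hK hO (fun a ha => ha) x
    have hyO : ∀ i < m, ∀ j, y i ≠ f^[j] (x m) := by
      intro i hi j hij
      by_cases hiK : x i ∈ K
      · refine hmin i hi hiK ?_
        rw [← hyK i hiK, hij]
        obtain ⟨n, hn, hper⟩ := hmper
        exact ⟨n, hn, hper.apply_iterate j⟩
      · exact (hyK' i hiK).2 ⟨j, hij.symm⟩
    have htail := htrack _ hmK hmper (fun i => x (m + i)) (fun i => hx₃ (m + i)) rfl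
    refine ⟨fun i => if i < m then y i else f^[i - m] (x m), fun i j hij => ?_, fun i => ?_,
      fun i => ?_⟩
    · by_cases hi : i < m <;> by_cases hj : j < m <;> simp only [hi, hj, if_true, if_false] at hij
      · rw [hinj y hyK (fun i hi => (hyK' i hi).1) hyinj i j (hmin i hi) (hmin j hj) hij]
      · exact absurd hij (hyO i hi _)
      · exact absurd hij.symm (hyO j hj _)
      · simp only [show ¬ i + 1 < m by omega, show ¬ j + 1 < m by omega, if_false,
          Nat.succ_sub (not_lt.1 hi), Nat.succ_sub (not_lt.1 hj), Function.iterate_succ_apply', hij]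
    · rcases lt_trichotomy (i + 1) m with hi | hi | hi
      · simp only [hi, show i < m by omega, if_true]
        exact hstep _ _ _ _ (hyx i) (hyx (i + 1)) (hx₁ i)
      · subst hi
        simp only [Nat.lt_succ_self, if_true, lt_irrefl, if_false, Nat.sub_self,
          Function.iterate_zero, id_eq]
        exact hstep _ _ _ _ (hyx i) (by simpa using hη) (hx₁ i)
      · simpa [show ¬ i < m by omega, show ¬ i + 1 < m by omega,
          Nat.succ_sub (show m ≤ i by omega), Function.iterate_succ_apply'] using hδ₁
    · by_cases hi : i < m
      · simpa only [hi, if_true] using (hyx i).trans_le hηε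
      · have := htail (i - m)
        simp only [orbitSeq, show m + (i - m) = i by omega] at this
        simpa only [hi, if_false] using this
  · push Not at hvisit
    obtain ⟨y, hyx, hyK, hyK', hyinj⟩ :=
      exists_perturbation_injective hη hK Set.finite_empty (fun a ha => ha) x
    refine ⟨y, fun i j hij => ?_, fun i => hstep _ _ _ _ (hyx i) (hyx (i + 1)) (hx₁ i),
      fun i => (hyx i).trans_le hηε⟩
    rw [hinj y hyK (fun i hi => (hyK' i hi).1) hyinj i j (hvisit i) (hvisit j) hij]

theorem mainTheorem5 {X : Type*} [MetricSpace X] [CompactSpace X]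
    (hX : TotallyDisconnectedSpace X ∨ ∃ F : CStructure X, F.IsMCSpace)
    (f : C(X, X)) :
    HasShadowing f ↔
      ∀ ε > 0, ∃ δ > 0, ∀ g : C(X, X), dist g f < δ →
        ∀ x : X, ∃ z : X, Shadows ε (orbitSeq f z) (orbitSeq g x) := by
  refine ⟨fun h => h.exists_shadows_orbitSeq, fun h => ?_⟩
  rcases hX with hX | ⟨F, hF⟩
  · exact (hasFinitePerturbations_of_totallyDisconnected f).hasShadowing h
  · exact (hF.hasFinitePerturbations f).hasShadowing h
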